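/- A large scale space is a set $X$ with a non-empty collection of covers of $X$, called uniformly bounded covers, such that (i) if $\mathcal U,\mathcal V$ are uniformly bounded, so is $\{\mathrm{st}(A,\mathcal V):A\in\mathcal U\}$, where $\mathrm{st}(A,\mathcal V)$ is the union of the members of $\mathcal V$ meeting $A$; (ii) every cover refining a uniformly bounded cover is uniformly bounded. Subsets of members of uniformly bounded covers are called bounded, and the union of two bounded sets is required to be bounded. A large scale group is a group $G$ with a large scale structure induced by a bornology $\mathcal B$ on $G$ (a cover of $G$ closed under subsets and finite unions): the uniformly bounded covers are exactly the covers refining $\{gB\}_{g\in G}$ for some $B\in\mathcal B$. A subset $A\subseteq X$ is coarsely clopen if $\mathrm{st}(A,\mathcal U)\cap \mathrm{st}(X\setminus A,\mathcal U)$ is bounded for every uniformly bounded cover $\mathcal U$. An end of $X$ is a family of unbounded coarsely clopen subsets that is maximal with respect to the property that all its finite intersections (the empty one being $X$) are unbounded. A map $f:X\to Y$ of large scale spaces is coarse if preimages of bounded sets are bounded, and large scale continuous if for each uniformly bounded cover $\mathcal U$ of $X$ the family $\{f(U):U\in\mathcal U\}$ refines a uniformly bounded cover of $Y$. Two maps $f,g$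 into $Y$ are close if there is a uniformly bounded cover $\mathcal U$ of $Y$ with $f(x)\in\mathrm{st}(\{g(x)\},\mathcal U)$ for all $x$. $X$ and $Y$ are coarsely equivalent if there are coarse, large scale continuous maps $X\to Y$ and $Y\to X$ whose two composites are close to the identities. $X$ has bounded geometry if it is coarsely equivalent to a large scale space $Y$ such that for each uniformly bounded cover $\mathcal U$ of $Y$ there is $N\in\mathbb N$ such that each member of $\mathcal U$ has at most $N$ elements. A large scale group $G$ is boundedly generated if there is a bounded set $K=K^{-1}\subseteq G$ such that every element of $G$ is a finite product of elements of $K$; it is $\sigma$-bounded if it is the union of a sequence of bounded subsets; a subgroup $H\le G$ is of bounded index if $B\cdot H=G$ for some bounded $B\subseteq G$. **Theorem 9.15.** Let $G$ be a large scale group of bounded geometry with exactly 2 ends. Then the following conditions are equivalent: 1. $G$ is boundedly generated, of bounded geometry, and has 2 ends. 2. $G$ is boundedly generated, of bounded geometry, $\sigma$-bounded, and has 2 ends. 3. $G$ contains an infinite cyclic subgroup of bounded index. -/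

import Mathlib

open scoped Pointwise

universe u v w

/-- The star of a set `A` with respect to a family `𝒰`: the union of all members of `𝒰` that
meet `A`. -/
def starOf {X : Type u} (A : Set X) (𝒰 : Set (Set X)) : Set X :=
  {y | ∃ x ∈ A, ∃ U ∈ 𝒰, x ∈ U ∧ y ∈ U}

/-- A large scale (coarse) space: a set together with a nonempty family of covers, called uniformly
bounded covers, closed under taking stars and under passing to refining covers. A subset is bounded if it is
contained in a member of some uniformly bounded cover; the space is coarsely connected, that is,
the union of two bounded sets is bounded. -/
class LargeScaleSpace (X : Type u) where
  IsUniformlyBounded : Set (Set X) → Prop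
  sUnion_eq_univ : ∀ 𝒰 : Set (Set X), IsUniformlyBounded 𝒰 → ⋃₀ 𝒰 = Set.univ
  exists_isUniformlyBounded : ∃ 𝒰, IsUniformlyBounded 𝒰
  star_family : ∀ 𝒰 𝒱 : Set (Set X), IsUniformlyBounded 𝒰 → IsUniformlyBounded 𝒱 →
    IsUniformlyBounded ((fun A => starOf A 𝒱) '' 𝒰)
  refinement : ∀ 𝒰 𝒱 : Set (Set X), IsUniformlyBounded 𝒰 → ⋃₀ 𝒱 = Set.univ →
    (∀ V ∈ 𝒱, ∃ U ∈ 𝒰, V ⊆ U) → IsUniformlyBounded 𝒱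
  union_bounded : ∀ A C : Set X,
    (∃ 𝒰, IsUniformlyBounded 𝒰 ∧ ∃ U ∈ 𝒰, A ⊆ U) →
    (∃ 𝒰, IsUniformlyBounded 𝒰 ∧ ∃ U ∈ 𝒰, C ⊆ U) →
    ∃ 𝒰, IsUniformlyBounded 𝒰 ∧ ∃ U ∈ 𝒰, A ∪ C ⊆ U

namespace LargeScale

open LargeScaleSpace

section Space

variable {X : Type u} [LargeScaleSpace X] {Y : Type v} [LargeScaleSpace Y]

/-- A set is bounded if it is contained in a member of a uniformly bounded cover. -/
def IsBounded (A : Set X) : Prop :=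
  ∃ 𝒰, IsUniformlyBounded 𝒰 ∧ ∃ U ∈ 𝒰, A ⊆ U

/-- `A` and `C` are coarsely disjoint if their stars with respect to any uniformly bounded cover
have bounded intersection. -/
def CoarselyDisjoint (A C : Set X) : Prop :=
  ∀ 𝒰, IsUniformlyBounded 𝒰 → IsBounded (starOf A 𝒰 ∩ starOf C 𝒰)

/-- `A` is coarsely clopen if it is coarsely disjoint from its complement. -/
def CoarselyClopen (A : Set X) : Prop :=
  CoarselyDisjoint A Aᶜ

/-- A family of unbounded coarsely clopen sets all of whose finite intersections are unbounded.
The empty intersection is the whole space. -/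
def IsPreEnd (E : Set (Set X)) : Prop :=
  (∀ A ∈ E, ¬ IsBounded A ∧ CoarselyClopen A) ∧
    ∀ F : Set (Set X), F.Finite → F ⊆ E → ¬ IsBounded (⋂₀ F)

variable (X) in
/-- The set of ends of `X`: the maximal families of unbounded coarsely clopen sets with all finite
intersections unbounded. -/
def Ends : Set (Set (Set X)) :=
  {E | Maximal IsPreEnd E}

/-- Two maps are close if, for some uniformly bounded cover `𝒰` of the target,
`f x ∈ st(g x, 𝒰)` for all `x`. -/
def Close {S : Type w} (f g : S → Y) : Prop :=
  ∃ 𝒰, IsUniformlyBounded 𝒰 ∧ ∀ x, f x ∈ starOf {g x} 𝒰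

/-- A map is coarse if preimages of bounded sets are bounded. -/
def IsCoarse (f : X → Y) : Prop :=
  ∀ K : Set Y, IsBounded K → IsBounded (f ⁻¹' K)

/-- A map is large scale continuous if it sends every uniformly bounded cover to a uniformly bounded
cover of the image, the image carrying the structure induced from the target. -/
def LargeScaleContinuous (f : X → Y) : Prop :=
  ∀ 𝒰, IsUniformlyBounded 𝒰 → ∃ 𝒱, IsUniformlyBounded 𝒱 ∧ ∀ U ∈ 𝒰, ∃ V ∈ 𝒱, f '' U ⊆ V

variable (X Y) in
/-- `X` and `Y` are coarsely equivalent: there are coarse, large scale continuous maps in both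
directions whose composites are close to the identities. -/
def CoarselyEquivalent : Prop :=
  ∃ (φ : X → Y) (ψ : Y → X), IsCoarse φ ∧ LargeScaleContinuous φ ∧
    IsCoarse ψ ∧ LargeScaleContinuous ψ ∧ Close (ψ ∘ φ) id ∧ Close (φ ∘ ψ) id

end Space

/-- `X` has bounded geometry if it is coarsely equivalent to a large scale space `Y` in which the
members of each uniformly bounded cover have a common finite bound on their cardinality. -/
def BoundedGeometry (X : Type u) [LargeScaleSpace X] : Prop :=
  ∃ (Y : Type u) (_ : LargeScaleSpace Y), CoarselyEquivalent X Y ∧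
    ∀ 𝒰 : Set (Set Y), IsUniformlyBounded 𝒰 → ∃ N : ℕ, ∀ U ∈ 𝒰, U.encard ≤ N

end LargeScale

/-- A large scale group: a group whose large scale structure is induced by a bornology, that is,
the uniformly bounded covers are exactly the covers refining `{g • B | g ∈ G}` for some member `B`
of the bornology. -/
class LargeScaleGroup (G : Type u) [Group G] [LargeScaleSpace G] : Prop where
  exists_bornology : ∃ ℬ : Bornology G, ∀ 𝒰 : Set (Set G),
    LargeScaleSpace.IsUniformlyBounded 𝒰 ↔
      ⋃₀ 𝒰 = Set.univ ∧ ∃ B : Set G, @Bornology.IsBounded G ℬ B ∧ ∀ U ∈ 𝒰, ∃ g : G, U ⊆ g • B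

namespace LargeScale

variable (G : Type u) [Group G] [LargeScaleSpace G]

/-- `G` is boundedly generated: there is a symmetric bounded set `K` such that each element of `G`
is a finite product of elements of `K`. -/
def BoundedlyGenerated : Prop :=
  ∃ K : Set G, IsBounded K ∧ K⁻¹ = K ∧ ∀ g : G, ∃ l : List G, (∀ x ∈ l, x ∈ K) ∧ l.prod = g

/-- `G` is `σ`-bounded: it is the union of a sequence of bounded subsets. -/
def SigmaBounded : Prop :=
  ∃ B : ℕ → Set G, (∀ n, IsBounded (B n)) ∧ ⋃ n, B n = Set.univ

variable {G} in
/-- `H` is of bounded index in `G`: there is a bounded set `B` with `B · H = G`. -/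
def BoundedIndex (H : Subgroup G) : Prop :=
  ∃ B : Set G, IsBounded B ∧ B * (H : Set G) = Set.univ

end LargeScale

/-! Only the passage to an infinite cyclic subgroup is hard. Split `G` into unbounded coarsely
clopen sets `A` and `Aᶜ`. With two ends, every translate of `A` agrees with `A` or `Aᶜ` up to a
bounded set (`translate_dichotomy`), and some `g` arbitrarily far out in `A` is of the first kind
(`exists_far_stabilizer`). Bounded geometry yields a generating set `K` whose powers absorb bounded
sets, so the boundary of `A` lies in one ball `D = K ^ n`. If `g` moves `D` off itself, `g • D` and
`g⁻¹ • D` each lie on one side of `A`; connectedness under `K` then forces `g • A ⊆ A`. Every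
`g`-orbit enters `A` going forward and leaves it going backward, so it meets the bounded set `A \ g
• A`; hence the powers of `g` have bounded index. -/

namespace LargeScale

open LargeScaleSpace

/-! ### Bounded sets, coarsely clopen sets and ends -/

section Space

variable {X : Type u} [LargeScaleSpace X]

theorem IsBounded.mono {A C : Set X} (hC : IsBounded C) (h : A ⊆ C) : IsBounded A := by
  obtain ⟨𝒰, h𝒰, U, hU, hCU⟩ := hC
  exact ⟨𝒰, h𝒰, U, hU, h.trans hCU⟩

theorem IsBounded.union {A C : Set X} (hA : IsBounded A) (hC : IsBounded C) :
    IsBounded (A ∪ C) :=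
  union_bounded A C hA hC

theorem isBounded_singleton (x : X) : IsBounded {x} := by
  obtain ⟨𝒰, h𝒰⟩ := exists_isUniformlyBounded (X := X)
  have hx : x ∈ ⋃₀ 𝒰 := by rw [sUnion_eq_univ 𝒰 h𝒰]; trivial
  obtain ⟨U, hU, hxU⟩ := hx
  exact ⟨𝒰, h𝒰, U, hU, by simpa using hxU⟩

theorem CoarselyClopen.compl {A : Set X} (hA : CoarselyClopen A) : CoarselyClopen Aᶜ := by
  intro 𝒰 h𝒰
  rw [compl_compl, Set.inter_comm]
  exact hA 𝒰 h𝒰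

theorem CoarselyClopen.inter {A C : Set X} (hA : CoarselyClopen A) (hC : CoarselyClopen C) :
    CoarselyClopen (A ∩ C) := by
  intro 𝒰 h𝒰
  refine ((hA 𝒰 h𝒰).union (hC 𝒰 h𝒰)).mono ?_
  rintro y ⟨⟨x, ⟨hxA, hxC⟩, U, hU, hxU, hyU⟩, z, hz, V, hV, hzV, hyV⟩
  by_cases hzA : z ∈ A
  · have hzC : z ∈ Cᶜ := fun h => hz ⟨hzA, h⟩
    exact Or.inr ⟨⟨x, hxC, U, hU, hxU, hyU⟩, z, hzC, V, hV, hzV, hyV⟩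
  · exact Or.inl ⟨⟨x, hxA, U, hU, hxU, hyU⟩, z, hzA, V, hV, hzV, hyV⟩

theorem IsPreEnd.exists_end {P : Set (Set X)} (hP : IsPreEnd P) : ∃ E ∈ Ends X, P ⊆ E := by
  obtain ⟨E, hPE, hE⟩ := zorn_subset_nonempty {E : Set (Set X) | IsPreEnd E} (by
    intro c hc hchain hne
    refine ⟨⋃₀ c, ⟨?_, ?_⟩, fun s hs => Set.subset_sUnion_of_mem hs⟩
    · rintro A ⟨E, hE, hA⟩
      exact (hc hE).1 A hA
    · intro F hF hFc
      obtain ⟨E, hE, hFE⟩ :=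
        hchain.directedOn.exists_mem_subset_of_finite_of_subset_sUnion hne hF hFc
      exact (hc hE).2 F hF hFE) P hP
  exact ⟨E, hE, hPE⟩

theorem CoarselyClopen.exists_end {A : Set X} (hA : CoarselyClopen A) (hb : ¬ IsBounded A) :
    ∃ E ∈ Ends X, A ∈ E := by
  have : IsPreEnd {A} := by
    refine ⟨by rintro _ rfl; exact ⟨hb, hA⟩, fun F _ hFA h => hb (h.mono ?_)⟩
    intro x hx B hB
    rw [hFA hB]
    exact hx
  obtain ⟨E, hE, hAE⟩ := this.exists_end
  exact ⟨E, hE, hAE rfl⟩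

theorem not_isBounded_inter_of_mem_end {E : Set (Set X)} (hE : E ∈ Ends X) {A C : Set X}
    (hA : A ∈ E) (hC : C ∈ E) : ¬ IsBounded (A ∩ C) := by
  have := hE.prop.2 {A, C} (Set.toFinite _) (by rintro _ (rfl | rfl) <;> assumption)
  rwa [Set.sInter_pair] at this

/-- A space with exactly two ends does not contain three pairwise disjoint unbounded coarsely
clopen sets. -/
theorem isBounded_of_pairwise_disjoint [Nonempty X] (hends : (Ends X).encard = 2) {A B C : Set X}
    (hA : CoarselyClopen A) (hB : CoarselyClopen B) (hC : CoarselyClopen C)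
    (hAB : Disjoint A B) (hAC : Disjoint A C) (hBC : Disjoint B C)
    (hbA : ¬ IsBounded A) (hbB : ¬ IsBounded B) : IsBounded C := by
  by_contra hbC
  obtain ⟨E₁, h₁, hA₁⟩ := hA.exists_end hbA
  obtain ⟨E₂, h₂, hB₂⟩ := hB.exists_end hbB
  obtain ⟨E₃, h₃, hC₃⟩ := hC.exists_end hbC
  have hempty : IsBounded (∅ : Set X) :=
    (isBounded_singleton (Classical.arbitrary X)).mono (Set.empty_subset _)
  have ne : ∀ {S T : Set X} {E F : Set (Set X)}, E ∈ Ends X → S ∈ E → T ∈ F → Disjoint S T →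
      E ≠ F := by
    rintro S T E _ hE hS hT hST rfl
    refine not_isBounded_inter_of_mem_end hE hS hT ?_
    rwa [hST.inter_eq]
  have h12 := ne h₁ hA₁ hB₂ hAB
  have h13 := ne h₁ hA₁ hC₃ hAC
  have h23 := ne h₂ hB₂ hC₃ hBC
  obtain ⟨E, F, -, hEF⟩ := Set.encard_eq_two.1 hends
  rw [hEF] at h₁ h₂ h₃
  grind

/-- A space with exactly two ends splits into two unbounded coarsely clopen sets. -/
theorem exists_coarselyClopen_unbounded (hends : (Ends X).encard = 2) :
    ∃ A : Set X, CoarselyClopen A ∧ ¬ IsBounded A ∧ ¬ IsBounded Aᶜ := by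
  obtain ⟨E, F, hne, hEF⟩ := Set.encard_eq_two.1 hends
  have hE : E ∈ Ends X := by simp [hEF]
  have hF : F ∈ Ends X := by simp [hEF]
  have hsub : ¬ E ⊆ F := fun h => hne (h.antisymm (hE.le_of_ge hF.prop h))
  obtain ⟨A, hAE, hAF⟩ := Set.not_subset.1 hsub
  obtain ⟨hbA, hA⟩ := hE.prop.1 A hAE
  refine ⟨A, hA, hbA, fun hbc => hAF ?_⟩
  have hpre : IsPreEnd (insert A F) := by
    refine ⟨?_, fun S hS hSF hb => ?_⟩
    · rintro B (rfl | hB)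
      · exact ⟨hbA, hA⟩
      · exact hF.prop.1 B hB
    -- Dropping `A` from the intersection enlarges it only inside `Aᶜ`, which is bounded; so `A` can
    -- be adjoined to the maximal family `F`.
    · refine hF.prop.2 (S \ {A}) (hS.subset Set.sdiff_subset) ?_ ((hb.union hbc).mono ?_)
      · rintro B ⟨hB, hBA⟩
        exact (hSF hB).resolve_left hBA
      · intro x hx
        by_cases hxA : x ∈ A
        · refine Or.inl fun B hB => ?_
          by_cases hBA : B = A
          · rwa [hBA]
          · exact hx B ⟨hB, hBA⟩
        · exact Or.inr hxA
  exact hF.le_of_ge hpre (Set.subset_insert _ _) (Set.mem_insert _ _)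

/-- In a space with exactly two ends, split by `A`, every coarsely clopen set agrees with one of
`∅`, `A`, `Aᶜ` and the whole space up to a bounded set. -/
theorem isBounded_inter_or_diff [Nonempty X] (hends : (Ends X).encard = 2) {A C : Set X}
    (hA : CoarselyClopen A) (hbA : ¬ IsBounded Aᶜ) (hC : CoarselyClopen C) :
    IsBounded (A ∩ C) ∨ IsBounded (A ∩ Cᶜ) := by
  by_contra! h
  exact hbA (isBounded_of_pairwise_disjoint hends (hA.inter hC) (hA.inter hC.compl) hA.compl
    (by rw [Set.disjoint_left]; rintro x ⟨-, h1⟩ ⟨-, h2⟩; exact h2 h1)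
    (by rw [Set.disjoint_left]; rintro x ⟨h1, -⟩ h2; exact h2 h1)
    (by rw [Set.disjoint_left]; rintro x ⟨h1, -⟩ h2; exact h2 h1) h.1 h.2)

end Space

/-! ### Connectedness with respect to a generating set -/

section Generators

variable {G : Type*} [Group G]

theorem list_prod_mem_pow {M : Type*} [Monoid M] {K : Set M} {l : List M}
    (h : ∀ x ∈ l, x ∈ K) : l.prod ∈ K ^ l.length := by
  induction l with
  | nil => simp
  | cons a l ih =>
    rw [List.prod_cons, List.length_cons, pow_succ']
    exact Set.mul_mem_mul (h a (by simp)) (ih fun x hx => h x (by simp [hx]))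

/-- A nonempty set stable under right multiplication by generators is everything. -/
theorem eq_univ_of_mul_mem {K S : Set G} (hgen : ∀ g : G, ∃ n, g ∈ K ^ n) {a : G} (ha : a ∈ S)
    (hS : ∀ x ∈ S, ∀ k ∈ K, x * k ∈ S) (g : G) : g ∈ S := by
  have key : ∀ n, ∀ x ∈ K ^ n, a * x ∈ S := by
    intro n
    induction n with
    | zero => rintro x hx; simpa [Set.mem_one.1 (by simpa using hx)] using ha
    | succ n ih =>
      rintro _ hx
      rw [pow_succ] at hx
      obtain ⟨y, hy, k, hk, rfl⟩ := hx
      simpa [mul_assoc] using hS _ (ih y hy) k hk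
  obtain ⟨n, hn⟩ := hgen (a⁻¹ * g)
  simpa using key n _ hn

/-- The points at which membership in `A` changes under right multiplication by `K`. -/
def edgeBoundary (A K : Set G) : Set G :=
  {x | ∃ k ∈ K, ¬ (x ∈ A ↔ x * k ∈ A)}

/-- A translate of a ball that misses the boundary of `A` lies on one side of `A`. -/
theorem mem_of_disjoint_edgeBoundary {A K : Set G} (h1 : 1 ∈ K) {g : G} (n : ℕ)
    (hd : Disjoint (g • K ^ n) (edgeBoundary A K)) :
    ∀ x ∈ g • K ^ n, (x ∈ A ↔ g ∈ A) := by
  induction n with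
  | zero =>
    rintro _ ⟨x, hx, rfl⟩
    rw [pow_zero, Set.mem_one] at hx
    simp [hx]
  | succ n ih =>
    rintro _ ⟨x, hx, rfl⟩
    have hsub : g • K ^ n ⊆ g • K ^ (n + 1) :=
      Set.smul_set_mono (Set.pow_subset_pow_right h1 n.le_succ)
    rw [pow_succ] at hx
    obtain ⟨y, hy, k, hk, rfl⟩ := hx
    have hgy : g * y ∈ g • K ^ n := ⟨y, hy, rfl⟩
    have := Set.disjoint_left.1 hd (hsub hgy)
    have hyk : (g * y ∈ A ↔ g * y * k ∈ A) := by_contra fun h => this ⟨k, hk, h⟩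
    simp only [smul_eq_mul, ← mul_assoc]
    rw [← hyk]
    exact ih (hd.mono_left hsub) _ hgy

theorem BoundedlyGenerated.exists_one_mem {G : Type u} [Group G]
    [LargeScaleSpace G] (h : BoundedlyGenerated G) :
    ∃ K : Set G, IsBounded K ∧ K⁻¹ = K ∧ 1 ∈ K ∧ ∀ g : G, ∃ n, g ∈ K ^ n := by
  obtain ⟨K, hK, hinv, hgen⟩ := h
  refine ⟨K ∪ {1}, hK.union (isBounded_singleton 1), by simp [hinv], by simp, fun g => ?_⟩
  obtain ⟨l, hl, rfl⟩ := hgen g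
  exact ⟨l.length, list_prod_mem_pow fun x hx => Or.inl (hl x hx)⟩

end Generators

/-! ### Bounded sets and coarsely clopen sets in large scale groups -/

section Group

variable {G : Type u} [Group G] [LargeScaleSpace G] [LargeScaleGroup G]

theorem exists_isBounded_translates {𝒰 : Set (Set G)} (h : IsUniformlyBounded 𝒰) :
    ∃ B : Set G, IsBounded B ∧ ∀ U ∈ 𝒰, ∃ g : G, U ⊆ g • B := by
  obtain ⟨ℬ, hℬ⟩ := LargeScaleGroup.exists_bornology (G := G)
  obtain ⟨-, B, hB, hU⟩ := (hℬ 𝒰).1 h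
  have hB1 : @Bornology.IsBounded G ℬ (B ∪ {1}) :=
    (@Bornology.isBounded_union G ℬ _ _).2 ⟨hB, @Bornology.isBounded_singleton G ℬ _⟩
  refine ⟨B, ⟨Set.range fun g : G => g • (B ∪ {1}), (hℬ _).2 ⟨?_, B ∪ {1}, hB1, ?_⟩,
    B ∪ {1}, ⟨1, one_smul _ _⟩, Set.subset_union_left⟩, hU⟩
  · refine Set.eq_univ_of_forall fun x => ⟨_, ⟨x, rfl⟩, 1, by simp, by simp⟩
  · rintro _ ⟨g, rfl⟩
    exact ⟨g, subset_rfl⟩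

theorem isUniformlyBounded_translates {B : Set G} (hB : IsBounded B) (h1 : 1 ∈ B) :
    IsUniformlyBounded (Set.range fun g : G => g • B) := by
  obtain ⟨ℬ, hℬ⟩ := LargeScaleGroup.exists_bornology (G := G)
  obtain ⟨𝒰, h𝒰, U, hU, hBU⟩ := hB
  obtain ⟨-, C, hC, h𝒰C⟩ := (hℬ 𝒰).1 h𝒰
  obtain ⟨a, ha⟩ := h𝒰C U hU
  refine (hℬ _).2 ⟨?_, C, hC, ?_⟩
  · exact Set.eq_univ_of_forall fun x => ⟨_, ⟨x, rfl⟩, 1, h1, by simp⟩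
  · rintro _ ⟨g, rfl⟩
    refine ⟨g * a, ?_⟩
    rw [mul_smul]
    exact Set.smul_set_mono (hBU.trans ha)

/-- This product is the star of `B` in the cover by its translates. Boundedness of inverses and of
products both follow from it. -/
theorem IsBounded.mul_inv_mul {B : Set G} (hB : IsBounded B) (h1 : 1 ∈ B) :
    IsBounded (B * B⁻¹ * B) := by
  have h := isUniformlyBounded_translates hB h1
  refine ⟨_, star_family _ _ h h, _, ⟨B, ⟨1, one_smul _ _⟩, rfl⟩, ?_⟩
  rintro _ ⟨_, ⟨b, hb, c, hc, rfl⟩, d, hd, rfl⟩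
  exact ⟨b, hb, (b * c) • B, ⟨_, rfl⟩, ⟨c⁻¹, hc, by simp⟩, ⟨d, hd, by simp⟩⟩

theorem IsBounded.inv {B : Set G} (hB : IsBounded B) : IsBounded B⁻¹ := by
  refine ((hB.union (isBounded_singleton 1)).mul_inv_mul (by simp)).mono fun x hx => ?_
  exact ⟨x, ⟨1, by simp, x, Or.inl hx, by simp⟩, 1, by simp, by simp⟩

theorem IsBounded.mul {B C : Set G} (hB : IsBounded B) (hC : IsBounded C) :
    IsBounded (B * C) := by
  refine (((hB.union hC).union (isBounded_singleton 1)).mul_inv_mul (by simp)).mono ?_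
  rintro _ ⟨b, hb, c, hc, rfl⟩
  exact ⟨b, ⟨b, by simp [hb], 1, by simp, by simp⟩, c, by simp [hc], rfl⟩

theorem IsBounded.pow {B : Set G} (hB : IsBounded B) (n : ℕ) : IsBounded (B ^ n) := by
  induction n with
  | zero => rw [pow_zero]; exact isBounded_singleton 1
  | succ n ih => rw [pow_succ]; exact ih.mul hB

theorem IsBounded.smul {B : Set G} (hB : IsBounded B) (g : G) : IsBounded (g • B) :=
  ((isBounded_singleton g).mul hB).mono (by rintro _ ⟨b, hb, rfl⟩; exact ⟨g, rfl, b, hb, rfl⟩)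

theorem isBounded_smul_iff {B : Set G} {g : G} : IsBounded (g • B) ↔ IsBounded B :=
  ⟨fun h => by simpa using h.smul g⁻¹, fun h => h.smul g⟩

theorem coarselyClopen_iff {A : Set G} :
    CoarselyClopen A ↔ ∀ B : Set G, IsBounded B → IsBounded (A * B ∩ Aᶜ) := by
  constructor
  · intro hA B hB
    have h := isUniformlyBounded_translates (hB.union (isBounded_singleton 1)) (by simp)
    refine (hA _ h).mono ?_
    rintro _ ⟨⟨a, ha, b, hb, rfl⟩, hab⟩
    exact ⟨⟨a, ha, _, ⟨a, rfl⟩, ⟨1, by simp, by simp⟩, ⟨b, by simp [hb], by simp⟩⟩,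
      a * b, hab, _, ⟨a * b, rfl⟩, ⟨1, by simp, by simp⟩, ⟨1, by simp, by simp⟩⟩
  · intro hA 𝒰 h𝒰
    obtain ⟨B, hB, hU⟩ := exists_isBounded_translates h𝒰
    have hD : IsBounded (B⁻¹ * B) := hB.inv.mul hB
    -- A point `y` of both stars is one `D`-step from some `x ∈ A` and from some `z ∉ A`, so `z` is
    -- two `D`-steps from `x`.
    refine ((hA _ (hD.mul hD)).mul hD).mono ?_
    have key : ∀ {x y : G} {U : Set G}, U ∈ 𝒰 → x ∈ U → y ∈ U → x⁻¹ * y ∈ B⁻¹ * B := by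
      intro x y U hU' hx hy
      obtain ⟨g, hg⟩ := hU U hU'
      obtain ⟨b, hb, rfl⟩ := hg hx
      obtain ⟨c, hc, rfl⟩ := hg hy
      exact ⟨b⁻¹, by simpa using hb, c, hc, by simp [mul_assoc]⟩
    rintro y ⟨⟨x, hx, U, hU', hxU, hyU⟩, z, hz, V, hV, hzV, hyV⟩
    refine ⟨z, ⟨⟨x, hx, x⁻¹ * z, ⟨_, key hU' hxU hyU, _, key hV hyV hzV, ?_⟩, ?_⟩, hz⟩,
      _, key hV hzV hyV, ?_⟩ <;> simp [mul_assoc]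

theorem CoarselyClopen.smul {A : Set G} (hA : CoarselyClopen A) (g : G) :
    CoarselyClopen (g • A) := by
  rw [coarselyClopen_iff] at hA ⊢
  intro B hB
  rw [smul_mul_assoc, ← Set.smul_set_compl, ← Set.smul_set_inter]
  exact (hA B hB).smul g

/-- In a large scale group of bounded geometry, bounded sets are covered by finitely many translates
of a single bounded set. -/
theorem BoundedGeometry.exists_finite_mul (h : BoundedGeometry G) :
    ∃ C : Set G, IsBounded C ∧
      ∀ B : Set G, IsBounded B → ∃ F : Set G, F.Finite ∧ B ⊆ F * C := by
  obtain ⟨Y, _, ⟨φ, ψ, -, hφ, -, -, ⟨𝒰, h𝒰, hclose⟩, -⟩, hY⟩ := h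
  obtain ⟨C, hC, h𝒰C⟩ := exists_isBounded_translates h𝒰
  refine ⟨C⁻¹ * C, hC.inv.mul hC, ?_⟩
  rintro B ⟨𝒲, h𝒲, W, hW, hBW⟩
  obtain ⟨𝒱, h𝒱, hV⟩ := hφ 𝒲 h𝒲
  obtain ⟨V, hV, hWV⟩ := hV W hW
  obtain ⟨N, hN⟩ := hY 𝒱 h𝒱
  have hfin : V.Finite := Set.finite_of_encard_le_coe (hN V hV)
  -- The round trip through `Y` moves points a bounded amount, and `φ '' B` lies in the finite set
  -- `V`.
  refine ⟨ψ '' (φ '' B), ((hfin.subset ((Set.image_mono hBW).trans hWV)).image ψ), fun x hx => ?_⟩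
  obtain ⟨y, rfl, U, hU, hyU, hxU⟩ := hclose x
  obtain ⟨g, hg⟩ := h𝒰C U hU
  obtain ⟨b, hb, hgb⟩ := hg hyU
  obtain ⟨c, hc, hgc⟩ := hg hxU
  refine ⟨_, ⟨_, ⟨_, hx, rfl⟩, rfl⟩, c⁻¹ * b, ⟨_, by simpa using hc, b, hb, rfl⟩, ?_⟩
  simp only [smul_eq_mul, Function.comp] at hgb hgc ⊢
  rw [← hgc, ← hgb]
  group

theorem BoundedlyGenerated.sigmaBounded (h : BoundedlyGenerated G) : SigmaBounded G := by
  obtain ⟨K, hK, -, -, hgen⟩ := h.exists_one_mem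
  exact ⟨fun n => K ^ n, hK.pow, Set.eq_univ_of_forall fun g => Set.mem_iUnion.2 (hgen g)⟩

/-- In a boundedly generated group of bounded geometry one can choose a bounded symmetric generating
set whose powers absorb all bounded sets. -/
theorem exists_absorbing_generators (h : BoundedlyGenerated G) (hgeom : BoundedGeometry G) :
    ∃ K : Set G, IsBounded K ∧ K⁻¹ = K ∧ 1 ∈ K ∧ (∀ g : G, ∃ n, g ∈ K ^ n) ∧
      ∀ B : Set G, IsBounded B → ∃ n, B ⊆ K ^ n := by
  obtain ⟨K, hK, hinv, h1, hgen⟩ := h.exists_one_mem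
  obtain ⟨C, hC, hfin⟩ := hgeom.exists_finite_mul
  -- With `C` among the generators, a bounded set inside `F * C`, `F` finite, costs one factor more
  -- than `F`.
  have hKK : K ⊆ K ∪ (C ∪ C⁻¹) := Set.subset_union_left
  have hone : 1 ∈ K ∪ (C ∪ C⁻¹) := hKK h1
  have hgen' : ∀ g : G, ∃ n, g ∈ (K ∪ (C ∪ C⁻¹)) ^ n := fun g =>
    (hgen g).imp fun n hn => Set.pow_subset_pow_left hKK hn
  refine ⟨K ∪ (C ∪ C⁻¹), hK.union (hC.union hC.inv), ?_, hone, hgen', fun B hB => ?_⟩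
  · simp [hinv, Set.union_comm]
  · obtain ⟨F, hF, hBF⟩ := hfin B hB
    choose n hn using hgen'
    obtain ⟨N, hN⟩ := (hF.image n).bddAbove
    refine ⟨N + 1, hBF.trans ?_⟩
    rw [pow_succ]
    refine Set.mul_subset_mul (fun x hx => ?_) fun x hx => Or.inr (Or.inl hx)
    exact Set.pow_subset_pow_right hone (hN ⟨x, hx, rfl⟩) (hn x)

theorem CoarselyClopen.isBounded_edgeBoundary {A K : Set G} (hA : CoarselyClopen A)
    (hK : IsBounded K) : IsBounded (edgeBoundary A K) := by
  have h1 := coarselyClopen_iff.1 hA K hK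
  have h2 := coarselyClopen_iff.1 hA _ hK.inv
  refine ((h1.mul hK.inv).union h2).mono ?_
  rintro x ⟨k, hk, hx⟩
  by_cases hxA : x ∈ A
  · have hxk : x * k ∉ A := fun h => hx ⟨fun _ => h, fun _ => hxA⟩
    exact Or.inl ⟨x * k, ⟨⟨x, hxA, k, hk, rfl⟩, hxk⟩, k⁻¹, by simpa using hk, by simp⟩
  · have hxk : x * k ∈ A := by_contra fun h => hx ⟨fun h' => absurd h' hxA, fun h' => absurd h' h⟩
    exact Or.inr ⟨⟨x * k, hxk, k⁻¹, by simpa using hk, by simp⟩, hxA⟩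

/-! ### Two-ended groups and the infinite cyclic subgroup -/

/-- In a two-ended group split by `A`, each translate of `A` agrees, up to a bounded set, with `A`
or with its complement. -/
theorem translate_dichotomy (hends : (Ends G).encard = 2) {A : Set G} (hA : CoarselyClopen A)
    (hb : ¬ IsBounded A) (hbc : ¬ IsBounded Aᶜ) (g : G) :
    IsBounded (symmDiff (g • A) A) ∨ IsBounded (symmDiff (g • A) Aᶜ) := by
  have hgb : ¬ IsBounded (g • A) := by rwa [isBounded_smul_iff]
  have hgc : ¬ IsBounded (g • A)ᶜ := by rwa [← Set.smul_set_compl, isBounded_smul_iff]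
  have h1 := isBounded_inter_or_diff hends hA hbc (hA.smul g)
  have h2 := isBounded_inter_or_diff hends hA.compl (by rwa [compl_compl]) (hA.smul g)
  rcases h1 with h1 | h1 <;> rcases h2 with h2 | h2
  · refine absurd ((h1.union h2).mono fun x hx => ?_) hgb
    by_cases hxA : x ∈ A
    · exact Or.inl ⟨hxA, hx⟩
    · exact Or.inr ⟨hxA, hx⟩
  · refine Or.inr ((h1.union h2).mono ?_)
    rintro x (⟨h, h'⟩ | ⟨h, h'⟩)
    · exact Or.inl ⟨not_not.1 h', h⟩
    · exact Or.inr ⟨h, h'⟩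
  · refine Or.inl ((h1.union h2).mono ?_)
    rintro x (⟨h, h'⟩ | ⟨h, h'⟩)
    · exact Or.inr ⟨h', h⟩
    · exact Or.inl ⟨h, h'⟩
  · refine absurd ((h1.union h2).mono fun x hx => ?_) hgc
    by_cases hxA : x ∈ A
    · exact Or.inl ⟨hxA, hx⟩
    · exact Or.inr ⟨hxA, hx⟩

/-- Arbitrarily far out in `A` there are elements translating `A` to itself up to a bounded set. -/
theorem exists_far_stabilizer (hends : (Ends G).encard = 2) {A : Set G} (hA : CoarselyClopen A)
    (hb : ¬ IsBounded A) (hbc : ¬ IsBounded Aᶜ) {E : Set G} (hE : IsBounded E) :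
    ∃ g ∈ A, g ∉ E ∧ IsBounded (symmDiff (g • A) A) := by
  by_contra! hcon
  have hcon' : ∀ g ∈ A, g ∉ E → IsBounded (symmDiff (g • A) Aᶜ) := fun g hg hgE =>
    (translate_dichotomy hends hA hb hbc g).resolve_left (hcon g hg hgE)
  obtain ⟨c, hcA, hcE⟩ : ∃ c ∈ A, c ∉ E := by
    by_contra! h
    exact hb (hE.mono h)
  have hcc := isBounded_singleton c
  have hX : IsBounded (Aᶜ * {c} ∩ A) := by
    simpa using coarselyClopen_iff.1 hA.compl {c} hcc
  -- If all far elements of `A` swapped the two sides, so would `c`, `g` and `g * c⁻¹`; but the last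
  -- undoes one swap by another. The excluded set keeps `g * c⁻¹` in `A` and outside `E`.
  obtain ⟨g, hgA, hg⟩ : ∃ g ∈ A, g ∉ E ∪ (E * {c} ∪ Aᶜ * {c} ∩ A) := by
    by_contra! h
    exact hb ((hE.union ((hE.mul hcc).union hX)).mono h)
  simp only [Set.mem_union, not_or] at hg
  obtain ⟨hgE, hgEc, hgX⟩ := hg
  have h1 : g * c⁻¹ ∈ A := by
    by_contra h
    exact hgX ⟨⟨_, h, c, rfl, by simp⟩, hgA⟩
  have h2 : g * c⁻¹ ∉ E := fun h => hgEc ⟨_, h, c, rfl, by simp⟩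
  refine hcon _ h1 h2 ?_
  have hc' := (hcon' c hcA hcE).smul (g * c⁻¹)
  have hg' := hcon' g hgA hgE
  refine (hc'.union hg').mono ?_
  have hmem : ∀ x, ((g * c⁻¹)⁻¹ * x ∈ c • A ↔ x ∈ g • A) := by
    intro x
    simp [Set.mem_smul_set_iff_inv_smul_mem, mul_assoc]
  intro x hx
  simp only [Set.mem_union, Set.mem_smul_set_iff_inv_smul_mem (a := g * c⁻¹), Set.mem_symmDiff,
    Set.mem_compl_iff, smul_eq_mul, hmem] at hx ⊢
  tauto

/-- In a two-ended boundedly generated group of bounded geometry, some infinite cyclic subgroup is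
of bounded index. -/
theorem exists_cyclic_boundedIndex (h : BoundedlyGenerated G) (hgeom : BoundedGeometry G)
    (hends : (Ends G).encard = 2) :
    ∃ H : Subgroup G, IsCyclic H ∧ Infinite H ∧ BoundedIndex H := by
  obtain ⟨A, hA, hb, hbc⟩ := exists_coarselyClopen_unbounded hends
  obtain ⟨K, hK, hinv, h1, hgen, habs⟩ := exists_absorbing_generators h hgeom
  obtain ⟨n, hn⟩ := habs _ (hA.isBounded_edgeBoundary hK)
  set D := K ^ n with hD
  have hDb : IsBounded D := hK.pow n
  have h1D : 1 ∈ D := Set.one_mem_pow h1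
  obtain ⟨g, hgA, hgD, hgstab⟩ := exists_far_stabilizer hends hA hb hbc (hDb.mul hDb.inv)
  have hdisj : ∀ x ∈ D, g * x ∉ D := fun x hx hgx =>
    hgD ⟨g * x, hgx, x⁻¹, by simpa using hx, by simp⟩
  have hgDA : ∀ x ∈ D, g * x ∈ A := fun x hx =>
    (mem_of_disjoint_edgeBoundary h1 n (Set.disjoint_left.2 (by
      rintro _ ⟨y, hy, rfl⟩ hy'
      exact hdisj y hy (hn hy'))) _ ⟨x, hx, rfl⟩).2 hgA
  have hDg : ∀ x ∈ D, (g⁻¹ * x ∈ A ↔ g⁻¹ ∈ A) := fun x hx =>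
    mem_of_disjoint_edgeBoundary h1 n (Set.disjoint_left.2 (by
      rintro _ ⟨y, hy, rfl⟩ hy'
      exact hdisj _ (hn hy') (by simpa using hy))) _ ⟨x, hx, rfl⟩
  have hcross : ∀ x k, k ∈ K → x ∉ D → (x ∈ A ↔ x * k ∈ A) := fun x k hk hx =>
    by_contra fun hc => hx (hn ⟨k, hk, hc⟩)
  have hcross' : ∀ x k, k ∈ K → x * k ∉ D → (x ∈ A ↔ x * k ∈ A) := fun x k hk hx => by
    simpa using (hcross (x * k) k⁻¹ (by rw [← hinv]; simpa using hk) hx).symm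
  have hnA : ∃ a, a ∈ A := by
    by_contra! h
    exact hb ((isBounded_singleton 1).mono fun x hx => absurd hx (h x))
  have hnAc : ∃ a, a ∉ A := by
    by_contra! h
    exact hbc ((isBounded_singleton 1).mono fun x hx => absurd (h x) hx)
  have hgnA : g⁻¹ ∉ A := by
    intro hg1
    -- Now `g⁻¹ • D ⊆ A`, so the complement of `A ∪ g • A` crosses no boundary and is empty or
    -- everything. Being empty, it puts `Aᶜ` inside the bounded set `g • A \ A`.
    have key : ∀ x, x ∈ A ∨ g⁻¹ * x ∈ A := by
      by_contra! hx
      obtain ⟨x, hx⟩ := hx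
      have := eq_univ_of_mul_mem (S := {x | x ∉ A ∧ g⁻¹ * x ∉ A}) hgen hx (by
        rintro y ⟨hy, hgy⟩ k hk
        have hyD : y ∉ D := fun hyD => hgy ((hDg y hyD).2 hg1)
        have hyk : y * k ∉ A := by rwa [← hcross y k hk hyD]
        refine ⟨hyk, fun hgyk => hyk ?_⟩
        have hD' : g⁻¹ * y ∈ D := hn ⟨k, hk, fun hc => hgy (hc.2 (by rwa [mul_assoc]))⟩
        exact absurd (by simpa using hgDA _ hD') hy)
      obtain ⟨a, ha⟩ := hnA
      exact (this a).1 ha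
    refine hbc (hgstab.mono fun x hx => Or.inl ⟨?_, hx⟩)
    rw [Set.mem_smul_set_iff_inv_smul_mem]
    exact (key x).resolve_left hx
  have hDgA : ∀ x ∈ D, g⁻¹ * x ∉ A := fun x hx => by rwa [hDg x hx]
  have hsub : ∀ x ∈ A, g * x ∈ A := by
    by_contra! hx
    obtain ⟨x, hx, hgx⟩ := hx
    have := eq_univ_of_mul_mem (S := {x | x ∈ A ∧ g * x ∉ A}) hgen ⟨hx, hgx⟩ (by
      rintro y ⟨hy, hgy⟩ k hk
      have hyD : y ∉ D := fun hyD => hgy (hgDA y hyD)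
      refine ⟨(hcross y k hk hyD).1 hy, fun hc => hgy ?_⟩
      rw [← mul_assoc] at hc
      refine (hcross (g * y) k hk fun hD' => hDgA _ hD' (by simpa using hy)).2 hc)
    obtain ⟨a, ha⟩ := hnAc
    exact ha (this a).1
  have hpow : ∀ (m : ℕ), ∀ x ∈ A, g ^ m * x ∈ A := by
    intro m
    induction m with
    | zero => simp
    | succ m ih => intro x hx; rw [pow_succ', mul_assoc]; exact hsub _ (ih x hx)
  have hpowD : ∀ x ∈ D, ∀ m : ℕ, g ^ (m + 1) * x ∈ A := fun x hx m => by
    rw [pow_succ, mul_assoc]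
    exact hpow m _ (hgDA x hx)
  -- Each orbit of `g` eventually enters `A` ...
  have hin : ∀ x, ∃ m : ℕ, g ^ m * x ∈ A := by
    obtain ⟨a, ha⟩ := hnA
    refine eq_univ_of_mul_mem (S := {x | ∃ m : ℕ, g ^ m * x ∈ A}) hgen ⟨0, by simpa using ha⟩ ?_
    rintro x ⟨m, hm⟩ k hk
    by_contra! hc
    simp only [Set.mem_ofPred_eq, not_exists] at hc
    -- Were the orbit of `x * k` never to enter `A`, the orbit of `x` would stay in the boundary
    -- from `m` on, although `g` moves `D` off itself.
    have hx : ∀ j : ℕ, g ^ (j + m) * x ∈ D := fun j => by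
      refine hn ⟨k, hk, fun hiff => hc (j + m) ?_⟩
      rw [← mul_assoc, ← hiff, pow_add, mul_assoc]
      exact hpow j _ hm
    refine hdisj _ (hx 0) ?_
    simpa [pow_add, mul_assoc] using hx 1
  -- ... and comes from outside of `A`.
  have hout : ∀ x, ∃ m : ℕ, (g ^ m)⁻¹ * x ∉ A := by
    obtain ⟨a, ha⟩ := hnAc
    refine eq_univ_of_mul_mem (S := {x | ∃ m : ℕ, (g ^ m)⁻¹ * x ∉ A}) hgen
      ⟨0, by simpa using ha⟩ ?_
    rintro x ⟨m, hm⟩ k hk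
    by_contra! hc
    simp only [Set.mem_ofPred_eq, not_exists, not_not] at hc
    have hx : ∀ j : ℕ, (g ^ (m + j))⁻¹ * x ∈ D := fun j => by
      refine hn ⟨k, hk, fun hiff => hm ?_⟩
      have := hiff.2 (by rw [mul_assoc]; exact hc (m + j))
      have := hpow j _ this
      rw [pow_add] at this
      simpa [mul_assoc] using this
    refine hdisj _ (hx 1) ?_
    simpa [pow_succ, mul_assoc] using hx 0
  refine ⟨Subgroup.zpowers g, inferInstance, ?_, ?_⟩
  · refine Set.infinite_coe_iff.2 (infinite_zpowers.2 ?_)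
    rw [isOfFinOrder_iff_pow_eq_one]
    rintro ⟨m, hm, hgm⟩
    obtain ⟨m, rfl⟩ := Nat.exists_eq_succ_of_ne_zero hm.ne'
    -- Doubling the exponent keeps the power positive even when `g = 1`, as `hpowD` needs.
    have hinv_eq : g⁻¹ = g ^ (2 * m + 1) := by
      rw [inv_eq_iff_mul_eq_one, ← pow_succ', show 2 * m + 1 + 1 = m.succ * 2 by omega, pow_mul,
        hgm, one_pow]
    refine hgnA ?_
    rw [hinv_eq]
    simpa using hpowD 1 h1D (2 * m)
  -- Left translates by powers of `g` of `A \ g • A` cover `G`; inverting puts the subgroup on the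
  -- right, whence `x⁻¹` below.
  · refine ⟨(A ∩ (g • A)ᶜ)⁻¹, (hgstab.mono fun x hx => Or.inr hx).inv, ?_⟩
    refine Set.eq_univ_of_forall fun x => ?_
    obtain ⟨z, hz, hz'⟩ : ∃ z : ℤ, g ^ z * x⁻¹ ∈ A ∧ g⁻¹ * (g ^ z * x⁻¹) ∉ A := by
      by_contra! hc
      obtain ⟨m, hm⟩ := hin x⁻¹
      have hall : ∀ j : ℕ, (g ^ j)⁻¹ * (g ^ m * x⁻¹) ∈ A := by
        intro j
        induction j with
        | zero => simpa using hm
        | succ j ih =>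
          have := hc (-j + m) (by simpa [zpow_add, mul_assoc] using ih)
          simpa [pow_succ, zpow_add, mul_assoc] using this
      obtain ⟨j, hj⟩ := hout (g ^ m * x⁻¹)
      exact hj (hall j)
    refine ⟨x * (g ^ z)⁻¹, ?_, g ^ z, ⟨z, rfl⟩, by simp⟩
    rw [Set.mem_inv, mul_inv_rev, inv_inv, Set.mem_inter_iff, Set.mem_compl_iff,
      Set.mem_smul_set_iff_inv_smul_mem]
    exact ⟨hz, hz'⟩

/-- Adjoining one generator of `H` to `B` suffices: each element is some `b ∈ B` times a power of
it. -/
theorem BoundedIndex.boundedlyGenerated {H : Subgroup G} [IsCyclic H] (hH : BoundedIndex H) :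
    BoundedlyGenerated G := by
  obtain ⟨B, hB, hBH⟩ := hH
  obtain ⟨⟨t, ht⟩, hgen⟩ := IsCyclic.exists_generator (α := H)
  have hbt := isBounded_singleton t
  refine ⟨(B ∪ {t}) ∪ (B ∪ {t})⁻¹, (hB.union hbt).union (hB.union hbt).inv, ?_, fun x => ?_⟩
  · rw [Set.union_inv, inv_inv, Set.union_comm]
  · obtain ⟨b, hb, y, hy, rfl⟩ : x ∈ B * (H : Set G) := by rw [hBH]; trivial
    obtain ⟨z, hz⟩ := hgen ⟨y, hy⟩
    have hz' : t ^ z = y := congrArg Subtype.val hz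
    rcases z.eq_nat_or_neg with ⟨m, rfl | rfl⟩
    · refine ⟨b :: List.replicate m t, ?_, by simp [← hz']⟩
      intro w hw
      rcases List.mem_cons.1 hw with rfl | hw
      · exact Or.inl (Or.inl hb)
      · rw [List.eq_of_mem_replicate hw]; simp
    · refine ⟨b :: List.replicate m t⁻¹, ?_, by simp [← hz']⟩
      intro w hw
      rcases List.mem_cons.1 hw with rfl | hw
      · exact Or.inl (Or.inl hb)
      · rw [List.eq_of_mem_replicate hw]; simp

end Group

end LargeScale

theorem theorem9p15 (G : Type*) [Group G] [LargeScaleSpace G] [LargeScaleGroup G]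
    (hgeom : LargeScale.BoundedGeometry G) (hends : (LargeScale.Ends G).encard = 2) :
    List.TFAE [
      LargeScale.BoundedlyGenerated G ∧ LargeScale.BoundedGeometry G ∧
        (LargeScale.Ends G).encard = 2,
      LargeScale.BoundedlyGenerated G ∧ LargeScale.BoundedGeometry G ∧
        LargeScale.SigmaBounded G ∧ (LargeScale.Ends G).encard = 2,
      ∃ H : Subgroup G, IsCyclic H ∧ Infinite H ∧ LargeScale.BoundedIndex H] := by
  tfae_have 1 → 2 := fun ⟨h, _, _⟩ => ⟨h, hgeom, h.sigmaBounded, hends⟩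
  tfae_have 2 → 3 := fun ⟨h, _, _, _⟩ => LargeScale.exists_cyclic_boundedIndex h hgeom hends
  tfae_have 3 → 1 := fun ⟨_, _, _, h⟩ => ⟨h.boundedlyGenerated, hgeom, hends⟩
  tfae_finish
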